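/- Let $p\le q$ and $m\ge 1$ be integers. Let $\mathbb R^q\oplus I(\mathbb R^q)\oplus\dots\oplus I^{m-1}(\mathbb R^q)$ be the orthogonal direct sum of $m$ copies of Euclidean space $\mathbb R^q$, where $I^r$ ($0\le r\le m-1$) denotes the isometric identification of $\mathbb R^q$ with the $r$-th summand ($I^0$ being the inclusion of $\mathbb R^q$ as the first summand, numbered $0$). For a linear subspace $V$ and vectors $z_0,\dots,z_{m-1}$ of this space let $|\langle V, z_0\wedge\dots\wedge z_{m-1}\rangle|$ be the $m$-dimensional volume (the square root of the Gram determinant) of the parallelepiped spanned by the orthogonal projections of $z_0,\dots,z_{m-1}$ to $V$. For an $mp$-plane (that is, an $mp$-dimensional linear subspace) $V$ put $$M(V)=\int_{S^{q-1}}|\langle V, x\wedge I(x)\wedge\dots\wedge I^{m-1}(x)\rangle|\,dx ,$$ where $dx$ is the standard surface measure of the unit sphere $S^{q-1}\subset\mathbb R^q$. Call $V$ maximal if $M(V)\ge M(V')$ for all $mp$-planes $V'$. (a) If $m\ne 2$, then an $mp$-plane $V$ is maximal if and only if $V=V^p\oplus I(V^p)\oplus\dots\oplus I^{m-1}(V^p)$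 for some $p$-dimensional subspace $V^p\subset\mathbb R^q$. (b) If $m=2$, then every $2p$-plane of the form $V=V^p\oplus I(V^p)$, with $V^p\subset\mathbb R^q$ a $p$-dimensional subspace, is maximal; and a $2p$-plane $V$ is maximal if and only if it is a complex subspace of $\mathbb R^q\oplus I(\mathbb R^q)\cong\mathbb C^q$, that is, $J(V)\subset V$ for the complex structure $J(x+I(y))=-y+I(x)$, $x,y\in\mathbb R^q$. -/

import Mathlib

noncomputable section

namespace SphereProjection

open MeasureTheory

/-- The orthogonal direct sum `ℝ^q ⊕ I(ℝ^q) ⊕ ⋯ ⊕ I^{m-1}(ℝ^q)` of `m` copies of the Euclidean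
space `ℝ^q`, with the Euclidean (`ℓ²`) inner product. -/
abbrev CopySum (m q : ℕ) : Type :=
  PiLp 2 (fun _ : Fin m => EuclideanSpace ℝ (Fin q))

/-- The map `I^r` on the first summand `ℝ^q`: the identification of `ℝ^q` with the
`r`-th summand of `ℝ^q ⊕ I(ℝ^q) ⊕ ⋯ ⊕ I^{m-1}(ℝ^q)`, `r = 0, …, m-1`. -/
def copy {m q : ℕ} (r : Fin m) : EuclideanSpace ℝ (Fin q) →ₗ[ℝ] CopySum m q where
  toFun x := WithLp.toLp 2 (Pi.single r x)
  map_add' x y := by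
    rw [Pi.single_add, WithLp.toLp_add]
  map_smul' c x := by
    rw [Pi.single_smul, WithLp.toLp_smul, RingHom.id_apply]

/-- The norm `|z₁ ∧ ⋯ ∧ z_m|` of a simple polyvector, that is, the `m`-dimensional volume of the
parallelepiped spanned by `z₁, …, z_m`: the square root of the Gram determinant. -/
def polyvectorVolume {E : Type*} [NormedAddCommGroup E] [InnerProductSpace ℝ E] {m : ℕ}
    (z : Fin m → E) : ℝ :=
  Real.sqrt (Matrix.det (Matrix.of fun i j : Fin m => inner ℝ (z i) (z j)))

/-- `|⟨V, z₁ ∧ ⋯ ∧ z_m⟩|`: the volume of the orthogonal projection of the simple polyvector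
`z₁ ∧ ⋯ ∧ z_m` to the plane `V`. -/
def projectedVolume {m q : ℕ} (V : Submodule ℝ (CopySum m q)) (z : Fin m → CopySum m q) : ℝ :=
  polyvectorVolume fun i => V.starProjection (z i)

/-- `M(V) = ∫_{S^{q-1}} |⟨V, x ∧ I(x) ∧ ⋯ ∧ I^{m-1}(x)⟩| dx`, with respect to the standard surface
measure of the unit sphere. -/
def sphereIntegral {m q : ℕ} (V : Submodule ℝ (CopySum m q)) : ℝ :=
  ∫ x : Metric.sphere (0 : EuclideanSpace ℝ (Fin q)) 1,
    projectedVolume V (fun r : Fin m => copy r (x : EuclideanSpace ℝ (Fin q)))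
    ∂((volume : Measure (EuclideanSpace ℝ (Fin q))).toSphere)

/-- `V` is an `mp`-plane at which `M` attains its maximum over all `mp`-planes. -/
def IsMaximalPlane {m q : ℕ} (p : ℕ) (V : Submodule ℝ (CopySum m q)) : Prop :=
  Module.finrank ℝ V = m * p ∧
    ∀ V' : Submodule ℝ (CopySum m q), Module.finrank ℝ V' = m * p →
      sphereIntegral V' ≤ sphereIntegral V

/-- `V = V^p ∧ I(V^p) ∧ ⋯ ∧ I^{m-1}(V^p)` (the span of `V^p, I(V^p), …, I^{m-1}(V^p)`) for some
`p`-dimensional subspace `V^p` of `ℝ^q`. -/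
def IsProductPlane {m q : ℕ} (p : ℕ) (V : Submodule ℝ (CopySum m q)) : Prop :=
  ∃ U : Submodule ℝ (EuclideanSpace ℝ (Fin q)), Module.finrank ℝ U = p ∧
    V = ⨆ r : Fin m, U.map (copy r)

/-- The complex structure `J` on `ℝ^q ⊕ I(ℝ^q)`: `J (x + I y) = -y + I x`. -/
def complexStructure (q : ℕ) : CopySum 2 q →ₗ[ℝ] CopySum 2 q where
  toFun z := copy 1 (z 0) - copy 0 (z 1)
  map_add' z w := by
    simp only [PiLp.add_apply, map_add]
    abel
  map_smul' c z := by
    simp only [PiLp.smul_apply, map_smul, RingHom.id_apply, smul_sub]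

end SphereProjection

end

/-! For `V` of dimension `mp` with orthogonal projection `P`, let `T` (`blockMean V`) be the average
of the `m` diagonal blocks of `P`. It is symmetric, lies between `0` and `1`, and has trace `p`. The
Gram matrix of the projected vectors `P (I^r x)` has trace `m⟨x, Tx⟩`, so the arithmetic-geometric
mean inequality bounds its volume by `⟨x, Tx⟩^(m/2)` (`copyVolume_le`). For a product plane `T` is
the projection to `V^p` and equality holds (`copyVolume_productPlane`).

It remains to maximize `∫ ⟨x, Tx⟩^(m/2)`, which by rotation invariance is a symmetric function of
the eigenvalues of `T`, a point of the hypersimplex `0 ≤ l i ≤ 1`, `∑ l i = p`. For `m > 2` it is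
strictly convex, so its maximizers are the vertices, that is, `T` is a projection
(`isIdempotentElem_of_formPower_le`); then `V` contains every copy of the range of `T` and equals
their sum by dimension (`eq_productPlane_of_isIdempotentElem`). For `m = 2` it depends only on the
trace, so `V` is maximal iff the mean inequality is an equality for all unit `x`, and after
polarization this says that `P` commutes with `J`. For `m = 1` every plane is a product. -/

noncomputable section

namespace SphereProjection

open MeasureTheory Set

variable {m q p : ℕ}

/-! ### Invariant integrals over the sphere -/

/-- The surface measure of the unit sphere is invariant under linear isometries. -/
theorem integral_sphere_comp_isometry (g : EuclideanSpace ℝ (Fin q) ≃ₗᵢ[ℝ] EuclideanSpace ℝ (Fin q))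
    (f : EuclideanSpace ℝ (Fin q) → ℝ) :
    ∫ x : Metric.sphere (0 : EuclideanSpace ℝ (Fin q)) 1, f (g x)
        ∂((volume : Measure (EuclideanSpace ℝ (Fin q))).toSphere) =
      ∫ x : Metric.sphere (0 : EuclideanSpace ℝ (Fin q)) 1, f x
        ∂((volume : Measure (EuclideanSpace ℝ (Fin q))).toSphere) := by
  let e : Metric.sphere (0 : EuclideanSpace ℝ (Fin q)) 1 ≃ₜ
      Metric.sphere (0 : EuclideanSpace ℝ (Fin q)) 1 :=
    g.toHomeomorph.subtype fun x => by simp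
  have he : ∀ x, ((e x : Metric.sphere (0 : EuclideanSpace ℝ (Fin q)) 1) :
      EuclideanSpace ℝ (Fin q)) = g x := fun x => rfl
  have hmp : MeasurePreserving e (volume : Measure (EuclideanSpace ℝ (Fin q))).toSphere
      (volume : Measure (EuclideanSpace ℝ (Fin q))).toSphere := by
    refine ⟨e.continuous.measurable, ?_⟩
    ext s hs
    -- `toSphere` is, up to the factor `q`, the volume of the cone over a set; `g` maps cones to
    -- cones and preserves volume.
    rw [Measure.map_apply e.continuous.measurable hs, Measure.toSphere_apply' _ hs,
      Measure.toSphere_apply' _ (e.continuous.measurable hs)]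
    congr 1
    rw [← g.symm.measurePreserving.measure_preimage_equiv
      (f := g.symm.toHomeomorph.toMeasurableEquiv)]
    congr 1
    ext y
    simp only [Set.mem_smul, Set.mem_image, Set.mem_preimage]
    constructor
    · rintro ⟨t, ht, _, ⟨x, hx, rfl⟩, hy⟩
      refine ⟨t, ht, _, ⟨e x, hx, rfl⟩, ?_⟩
      apply g.symm.injective
      rw [map_smul, he, g.symm_apply_apply]
      exact hy
    · rintro ⟨t, ht, _, ⟨x, hx, rfl⟩, hy⟩
      refine ⟨t, ht, _, ⟨e.symm x, by simpa using hx, rfl⟩, ?_⟩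
      change _ = g.symm y
      rw [← hy, map_smul]
      congr 1
  exact hmp.integral_comp e.measurableEmbedding (fun x => f x)

/-- The integral over the unit sphere of the `s`-th power of the quadratic form with
eigenbasis `b` and eigenvalues `l`. -/
def diagonalPower (b : OrthonormalBasis (Fin q) ℝ (EuclideanSpace ℝ (Fin q))) (s : ℝ)
    (l : Fin q → ℝ) : ℝ :=
  ∫ x : Metric.sphere (0 : EuclideanSpace ℝ (Fin q)) 1,
    (∑ i, l i * inner ℝ (b i) (x : EuclideanSpace ℝ (Fin q)) ^ 2) ^ s
    ∂((volume : Measure (EuclideanSpace ℝ (Fin q))).toSphere)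

theorem diagonalPower_basis_eq (b c : OrthonormalBasis (Fin q) ℝ (EuclideanSpace ℝ (Fin q)))
    (s : ℝ) (l : Fin q → ℝ) : diagonalPower b s l = diagonalPower c s l := by
  have h := integral_sphere_comp_isometry (b.equiv c (Equiv.refl _))
    (fun x => (∑ i, l i * inner ℝ (c i) x ^ 2) ^ s)
  unfold diagonalPower
  rw [← h]
  refine integral_congr_ae (.of_forall fun x => ?_)
  have : ∀ i, c i = b.equiv c (Equiv.refl _) (b i) := fun i => by simp
  simp only [this, LinearIsometryEquiv.inner_map_map]

theorem diagonalPower_comp_perm (b : OrthonormalBasis (Fin q) ℝ (EuclideanSpace ℝ (Fin q)))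
    (s : ℝ) (l : Fin q → ℝ) (σ : Equiv.Perm (Fin q)) :
    diagonalPower b s (l ∘ σ) = diagonalPower b s l := by
  rw [diagonalPower_basis_eq b (b.reindex σ.symm)]
  unfold diagonalPower
  refine integral_congr_ae (.of_forall fun x => ?_)
  dsimp only
  congr 1
  rw [← Equiv.sum_comp σ (fun i => l i * inner ℝ (b i) (x : EuclideanSpace ℝ (Fin q)) ^ 2)]
  simp

theorem continuous_diagonalPower (b : OrthonormalBasis (Fin q) ℝ (EuclideanSpace ℝ (Fin q)))
    {s : ℝ} (hs : 0 ≤ s) : Continuous (diagonalPower b s) := by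
  have h := continuous_parametric_integral_of_continuous
    (μ := (volume : Measure (EuclideanSpace ℝ (Fin q))).toSphere)
    (f := fun (l : Fin q → ℝ) (x : Metric.sphere (0 : EuclideanSpace ℝ (Fin q)) 1) =>
      (∑ i, l i * inner ℝ (b i) (x : EuclideanSpace ℝ (Fin q)) ^ 2) ^ s)
    (s := univ) (by
      refine Continuous.rpow_const ?_ fun _ => Or.inr hs
      fun_prop) isCompact_univ
  simpa [diagonalPower] using! h

theorem integrable_sphere_of_continuous
    {f : Metric.sphere (0 : EuclideanSpace ℝ (Fin q)) 1 → ℝ} (hf : Continuous f) :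
    Integrable f (volume : Measure (EuclideanSpace ℝ (Fin q))).toSphere :=
  hf.integrable_of_hasCompactSupport (HasCompactSupport.of_compactSpace f)

/-- A continuous function on the sphere that dominates another with the same integral
equals it. -/
theorem eq_of_integral_sphere_le
    {f g : Metric.sphere (0 : EuclideanSpace ℝ (Fin q)) 1 → ℝ} (hf : Continuous f)
    (hg : Continuous g) (hfg : ∀ x, f x ≤ g x)
    (h : ∫ x, g x ∂(volume : Measure (EuclideanSpace ℝ (Fin q))).toSphere ≤
      ∫ x, f x ∂(volume : Measure (EuclideanSpace ℝ (Fin q))).toSphere) : f = g := by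
  by_contra hne
  obtain ⟨x, hx⟩ := Function.ne_iff.1 hne
  have := (hg.sub hf).integral_pos_of_hasCompactSupport_nonneg_nonzero
    (μ := (volume : Measure (EuclideanSpace ℝ (Fin q))).toSphere)
    (HasCompactSupport.of_compactSpace _) (fun y => sub_nonneg.2 (hfg y))
    (x := x) (sub_ne_zero.2 (Ne.symm hx))
  simp only [Pi.sub_apply] at this
  rw [integral_sub (integrable_sphere_of_continuous hg) (integrable_sphere_of_continuous hf)]
    at this
  linarith

/-! ### Convexity on the hypersimplex -/

/-- Moving two coordinates in opposite directions increases `diagonalPower` on average. -/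
theorem diagonalPower_lt_midpoint (b : OrthonormalBasis (Fin q) ℝ (EuclideanSpace ℝ (Fin q)))
    {s : ℝ} (hs : 1 < s) {l₁ l₂ : Fin q → ℝ} (h₁ : ∀ i, 0 ≤ l₁ i) (h₂ : ∀ i, 0 ≤ l₂ i)
    (hne : l₁ ≠ l₂) :
    2 * diagonalPower b s (fun i => (l₁ i + l₂ i) / 2) <
      diagonalPower b s l₁ + diagonalPower b s l₂ := by
  have hcont : ∀ l : Fin q → ℝ, Continuous
      fun x : Metric.sphere (0 : EuclideanSpace ℝ (Fin q)) 1 =>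
        (∑ i, l i * inner ℝ (b i) (x : EuclideanSpace ℝ (Fin q)) ^ 2) ^ s := fun l => by
    refine Continuous.rpow_const ?_ fun _ => Or.inr (by linarith)
    fun_prop
  have hnn : ∀ l : Fin q → ℝ, (∀ i, 0 ≤ l i) → ∀ x : EuclideanSpace ℝ (Fin q),
      0 ≤ ∑ i, l i * inner ℝ (b i) x ^ 2 := fun l hl x =>
    Finset.sum_nonneg fun i _ => mul_nonneg (hl i) (sq_nonneg _)
  have hmid : ∀ x : EuclideanSpace ℝ (Fin q),
      ∑ i, (l₁ i + l₂ i) / 2 * inner ℝ (b i) x ^ 2 =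
        (1 / 2 : ℝ) • (∑ i, l₁ i * inner ℝ (b i) x ^ 2) +
          (1 / 2 : ℝ) • (∑ i, l₂ i * inner ℝ (b i) x ^ 2) := fun x => by
    simp only [smul_eq_mul, Finset.mul_sum, ← Finset.sum_add_distrib]
    exact Finset.sum_congr rfl fun i _ => by ring
  by_contra! hle
  have heq := eq_of_integral_sphere_le (q := q)
    (g := fun x => (∑ i, l₁ i * inner ℝ (b i) (x : EuclideanSpace ℝ (Fin q)) ^ 2) ^ s +
      (∑ i, l₂ i * inner ℝ (b i) (x : EuclideanSpace ℝ (Fin q)) ^ 2) ^ s)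
    ((hcont fun i => (l₁ i + l₂ i) / 2).const_mul 2) ((hcont l₁).add (hcont l₂))
    (fun x => by
      have := (strictConvexOn_rpow hs).convexOn.2 (hnn l₁ h₁ x) (hnn l₂ h₂ x)
        (show (0 : ℝ) ≤ 1 / 2 by norm_num) (show (0 : ℝ) ≤ 1 / 2 by norm_num) (by norm_num)
      simp only [hmid]
      simp only [smul_eq_mul] at this ⊢
      linarith)
    (by
      rw [integral_const_mul, integral_add (integrable_sphere_of_continuous (hcont l₁))
        (integrable_sphere_of_continuous (hcont l₂))]
      exact hle)
  -- At the point `b j` the form takes the value `l j`, so strict convexity of the power at a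
  -- coordinate where `l₁` and `l₂` differ contradicts pointwise equality.
  obtain ⟨j, hj⟩ := Function.ne_iff.1 hne
  have hbj : ∀ l : Fin q → ℝ, ∑ i, l i * inner ℝ (b i) (b j) ^ 2 = l j := fun l => by
    simp [b.inner_eq_ite]
  have hj' := congrFun heq ⟨b j, by simp⟩
  have hlt := (strictConvexOn_rpow hs).2 (h₁ j) (h₂ j) hj
    (show (0 : ℝ) < 1 / 2 by norm_num) (show (0 : ℝ) < 1 / 2 by norm_num) (by norm_num)
  have hbm := hmid (b j)
  simp only [hbj] at hj' hbm
  rw [hbm] at hj'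
  simp only [smul_eq_mul] at hj' hlt
  linarith

/-- Vectors with entries `0, 1` and the same sum differ by a permutation. -/
theorem exists_perm_of_zero_one {l k : Fin q → ℝ} (hl : ∀ i, l i = 0 ∨ l i = 1)
    (hk : ∀ i, k i = 0 ∨ k i = 1) (h : ∑ i, l i = ∑ i, k i) :
    ∃ σ : Equiv.Perm (Fin q), l = k ∘ σ := by
  classical
  have hcard : ∀ f : Fin q → ℝ, (∀ i, f i = 0 ∨ f i = 1) →
      ∑ i, f i = (Fintype.card {i // f i = 1} : ℝ) := fun f hf => by
    rw [Fintype.card_subtype, Finset.card_filter]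
    push_cast
    refine Finset.sum_congr rfl fun i _ => ?_
    rcases hf i with hi | hi <;> simp [hi]
  have hc : Fintype.card {i // l i = 1} = Fintype.card {i // k i = 1} := by
    rw [hcard l hl, hcard k hk] at h
    exact_mod_cast h
  let e := Fintype.equivOfCardEq hc
  refine ⟨e.extendSubtype, funext fun i => ?_⟩
  by_cases hi : l i = 1
  · rw [Function.comp_apply, hi, e.extendSubtype_mem i hi]
  · have := e.extendSubtype_not_mem i hi
    rw [Function.comp_apply, (hl i).resolve_right hi, (hk _).resolve_right this]

theorem diagonalPower_eq_of_zero_one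
    (b c : OrthonormalBasis (Fin q) ℝ (EuclideanSpace ℝ (Fin q))) (s : ℝ) {l k : Fin q → ℝ}
    (hl : ∀ i, l i = 0 ∨ l i = 1) (hk : ∀ i, k i = 0 ∨ k i = 1) (h : ∑ i, l i = ∑ i, k i) :
    diagonalPower b s l = diagonalPower c s k := by
  obtain ⟨σ, rfl⟩ := exists_perm_of_zero_one hl hk h
  rw [diagonalPower_comp_perm, diagonalPower_basis_eq b c]

/-- A vector of the unit cube with integral sum and an entry strictly between `0` and `1`
has another one. -/
theorem exists_ne_fractional {l : Fin q → ℝ} (hl : ∀ i, l i ∈ Icc (0 : ℝ) 1) {p : ℕ}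
    (hp : ∑ i, l i = p) {i : Fin q} (hi : ¬ (l i = 0 ∨ l i = 1)) :
    ∃ j, j ≠ i ∧ ¬ (l j = 0 ∨ l j = 1) := by
  classical
  by_contra! hcon
  -- If all other entries are `0` or `1`, their sum is an integer `n`, and then `n < p < n + 1`.
  have hsum : ∃ n : ℕ, ∑ j ∈ Finset.univ.erase i, l j = n := by
    refine ⟨∑ j ∈ Finset.univ.erase i, if l j = 1 then 1 else 0, ?_⟩
    push_cast
    refine Finset.sum_congr rfl fun j hj => ?_
    rcases hcon j (Finset.ne_of_mem_erase hj) with h | h <;> simp [h]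
  obtain ⟨n, hn⟩ := hsum
  rw [← Finset.add_sum_erase _ _ (Finset.mem_univ i), hn] at hp
  push Not at hi
  have h0 : (0 : ℝ) < l i := lt_of_le_of_ne (hl i).1 (Ne.symm hi.1)
  have h1 : l i < 1 := lt_of_le_of_ne (hl i).2 hi.2
  have h2 : n < p := by
    have : (n : ℝ) < p := by linarith
    exact_mod_cast this
  have h3 : p < n + 1 := by
    have : (p : ℝ) < n + 1 := by linarith
    exact_mod_cast this
  omega

/-- On the hypersimplex, `diagonalPower` is maximal only at the vertices. -/
theorem zero_one_of_isMaxOn_diagonalPower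
    (b : OrthonormalBasis (Fin q) ℝ (EuclideanSpace ℝ (Fin q))) {s : ℝ} (hs : 1 < s) {p : ℕ}
    {l : Fin q → ℝ} (hl : ∀ i, l i ∈ Icc (0 : ℝ) 1) (hp : ∑ i, l i = p)
    (hmax : ∀ k : Fin q → ℝ, (∀ i, k i ∈ Icc (0 : ℝ) 1) → ∑ i, k i = p →
      diagonalPower b s k ≤ diagonalPower b s l) (i : Fin q) : l i = 0 ∨ l i = 1 := by
  classical
  by_contra hi
  obtain ⟨j, hji, hj⟩ := exists_ne_fractional hl hp hi
  push Not at hi hj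
  have hi0 : 0 < l i := lt_of_le_of_ne (hl i).1 (Ne.symm hi.1)
  have hi1 : 0 < 1 - l i := sub_pos.2 (lt_of_le_of_ne (hl i).2 hi.2)
  have hj0 : 0 < l j := lt_of_le_of_ne (hl j).1 (Ne.symm hj.1)
  have hj1 : 0 < 1 - l j := sub_pos.2 (lt_of_le_of_ne (hl j).2 hj.2)
  obtain ⟨t, ht, htle⟩ : ∃ t : ℝ, 0 < t ∧ (t ≤ l i ∧ t ≤ 1 - l i) ∧ t ≤ l j ∧ t ≤ 1 - l j :=
    ⟨min (min (l i) (1 - l i)) (min (l j) (1 - l j)), by positivity, by simp⟩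
  obtain ⟨⟨hti0, hti1⟩, htj0, htj1⟩ := htle
  -- The direction `d` keeps the sum, and `t` is small enough for `l + d` and `l - d` to stay in the
  -- cube; `l` is their midpoint, so one of them has a larger value.
  let d : Fin q → ℝ := Pi.single i t - Pi.single j t
  have hdi : d i = t := by simp [d, hji.symm]
  have hdj : d j = -t := by simp [d, hji]
  have hdk : ∀ k, k ≠ i → k ≠ j → d k = 0 := fun k h1 h2 => by
    simp [d, h1, h2]
  have hdsum : ∑ k, d k = 0 := by simp [d, Finset.sum_sub_distrib]
  have hmem : ∀ k, (l k + d k) ∈ Icc (0 : ℝ) 1 ∧ (l k - d k) ∈ Icc (0 : ℝ) 1 := fun k => by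
    by_cases h1 : k = i
    · subst h1
      rw [hdi]
      refine ⟨⟨?_, ?_⟩, ?_, ?_⟩ <;> linarith
    · by_cases h2 : k = j
      · subst h2
        rw [hdj]
        refine ⟨⟨?_, ?_⟩, ?_, ?_⟩ <;> linarith
      · rw [hdk k h1 h2]
        simpa using hl k
  have hlt := diagonalPower_lt_midpoint b hs (l₁ := fun k => l k + d k)
    (l₂ := fun k => l k - d k) (fun k => (hmem k).1.1) (fun k => (hmem k).2.1)
    (fun h => by
      have := congrFun h i
      simp only [hdi] at this
      linarith)
  have h1 := hmax (fun k => l k + d k) (fun k => (hmem k).1)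
    (by rw [Finset.sum_add_distrib, hdsum, hp, add_zero])
  have h2 := hmax (fun k => l k - d k) (fun k => (hmem k).2)
    (by rw [Finset.sum_sub_distrib, hdsum, hp, sub_zero])
  have hmid : (fun k => (l k + d k + (l k - d k)) / 2) = l := funext fun k => by ring
  rw [hmid] at hlt
  linarith

/-- The maximum of `diagonalPower` on the hypersimplex is its value at any vertex. -/
theorem diagonalPower_le_zero_one
    (b : OrthonormalBasis (Fin q) ℝ (EuclideanSpace ℝ (Fin q))) {s : ℝ} (hs : 1 < s) {p : ℕ}
    {l k : Fin q → ℝ} (hl : ∀ i, l i ∈ Icc (0 : ℝ) 1) (hp : ∑ i, l i = p)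
    (hk : ∀ i, k i = 0 ∨ k i = 1) (hkp : ∑ i, k i = p) :
    diagonalPower b s l ≤ diagonalPower b s k := by
  -- By compactness a maximizer exists; it is a vertex, and all vertices have the same value by
  -- symmetry.
  have hK : IsCompact ((univ.pi fun _ : Fin q => Icc (0 : ℝ) 1) ∩ {l | ∑ i, l i = (p : ℝ)}) :=
    (isCompact_univ_pi fun _ => isCompact_Icc).inter_right
      (isClosed_eq (by fun_prop) continuous_const)
  obtain ⟨n, ⟨hn, hnp⟩, hmax⟩ := hK.exists_isMaxOn ⟨l, fun i _ => hl i, hp⟩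
    (continuous_diagonalPower b (by linarith : 0 ≤ s)).continuousOn
  have hn' := zero_one_of_isMaxOn_diagonalPower b hs (fun i => hn i (mem_univ i)) hnp
    fun k hk hkp => hmax ⟨fun i _ => hk i, hkp⟩
  rw [diagonalPower_eq_of_zero_one b b s hk hn' (hkp.trans (Eq.symm hnp))]
  exact hmax ⟨fun i _ => hl i, hp⟩

/-! ### From eigenvalues to symmetric operators -/

/-- The integral over the unit sphere of the `s`-th power of the quadratic form of `T`. -/
def formPower (s : ℝ) (T : EuclideanSpace ℝ (Fin q) →ₗ[ℝ] EuclideanSpace ℝ (Fin q)) : ℝ :=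
  ∫ x : Metric.sphere (0 : EuclideanSpace ℝ (Fin q)) 1,
    (inner ℝ (x : EuclideanSpace ℝ (Fin q)) (T x)) ^ s
    ∂((volume : Measure (EuclideanSpace ℝ (Fin q))).toSphere)

theorem inner_apply_eq_sum {T : EuclideanSpace ℝ (Fin q) →ₗ[ℝ] EuclideanSpace ℝ (Fin q)}
    {b : OrthonormalBasis (Fin q) ℝ (EuclideanSpace ℝ (Fin q))} {l : Fin q → ℝ}
    (hb : ∀ i, T (b i) = l i • b i) (x : EuclideanSpace ℝ (Fin q)) :
    inner ℝ x (T x) = ∑ i, l i * inner ℝ (b i) x ^ 2 := by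
  have h : T x = ∑ i, inner ℝ (b i) x • l i • b i := by
    conv_lhs => rw [← b.sum_repr' x]
    simp [map_sum, hb]
  rw [h, inner_sum]
  refine Finset.sum_congr rfl fun i _ => ?_
  rw [inner_smul_right, inner_smul_right, real_inner_comm]
  ring

theorem formPower_eq_diagonalPower
    {T : EuclideanSpace ℝ (Fin q) →ₗ[ℝ] EuclideanSpace ℝ (Fin q)}
    {b : OrthonormalBasis (Fin q) ℝ (EuclideanSpace ℝ (Fin q))} {l : Fin q → ℝ}
    (hb : ∀ i, T (b i) = l i • b i) (s : ℝ) : formPower s T = diagonalPower b s l := by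
  simp only [formPower, diagonalPower, inner_apply_eq_sum hb]

theorem exists_eigenbasis {T : EuclideanSpace ℝ (Fin q) →ₗ[ℝ] EuclideanSpace ℝ (Fin q)}
    (hT : T.IsSymmetric) :
    ∃ (b : OrthonormalBasis (Fin q) ℝ (EuclideanSpace ℝ (Fin q))) (l : Fin q → ℝ),
      (∀ i, T (b i) = l i • b i) ∧ ∑ i, l i = LinearMap.trace ℝ _ T ∧
        ∀ i, l i = inner ℝ (b i) (T (b i)) :=
  have hb : ∀ i, T (hT.eigenvectorBasis finrank_euclideanSpace_fin i) =
      hT.eigenvalues finrank_euclideanSpace_fin i •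
        hT.eigenvectorBasis finrank_euclideanSpace_fin i :=
    hT.apply_eigenvectorBasis finrank_euclideanSpace_fin
  ⟨hT.eigenvectorBasis finrank_euclideanSpace_fin, hT.eigenvalues finrank_euclideanSpace_fin,
    hb, (hT.trace_eq_sum_eigenvalues finrank_euclideanSpace_fin).symm, fun i => by
      rw [hb, inner_smul_right, real_inner_self_eq_norm_sq, OrthonormalBasis.norm_eq_one]
      simp⟩

theorem isIdempotentElem_iff_zero_one
    {T : EuclideanSpace ℝ (Fin q) →ₗ[ℝ] EuclideanSpace ℝ (Fin q)}
    {b : OrthonormalBasis (Fin q) ℝ (EuclideanSpace ℝ (Fin q))} {l : Fin q → ℝ}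
    (hb : ∀ i, T (b i) = l i • b i) : IsIdempotentElem T ↔ ∀ i, l i = 0 ∨ l i = 1 := by
  have key : ∀ i, (T * T) (b i) = T (b i) ↔ l i = 0 ∨ l i = 1 := fun i => by
    rw [Module.End.mul_apply, hb, map_smul, hb, smul_smul,
      (smul_left_injective ℝ (b.orthonormal.ne_zero i)).eq_iff]
    exact IsIdempotentElem.iff_eq_zero_or_one
  refine ⟨fun h i => (key i).1 (by rw [h.eq]), fun h => ?_⟩
  exact b.toBasis.ext fun i => by simpa using (key i).2 (h i)

/-- Orthogonal projections of the same rank have the same `formPower`. -/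
theorem formPower_eq_of_isIdempotentElem (s : ℝ)
    {T R : EuclideanSpace ℝ (Fin q) →ₗ[ℝ] EuclideanSpace ℝ (Fin q)}
    (hT : T.IsSymmetric) (hTi : IsIdempotentElem T) (hR : R.IsSymmetric)
    (hRi : IsIdempotentElem R) (h : LinearMap.trace ℝ _ T = LinearMap.trace ℝ _ R) :
    formPower s T = formPower s R := by
  obtain ⟨b, l, hb, hl, -⟩ := exists_eigenbasis hT
  obtain ⟨c, k, hc, hk, -⟩ := exists_eigenbasis hR
  rw [formPower_eq_diagonalPower hb, formPower_eq_diagonalPower hc]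
  exact diagonalPower_eq_of_zero_one b c s ((isIdempotentElem_iff_zero_one hb).1 hTi)
    ((isIdempotentElem_iff_zero_one hc).1 hRi) (by rw [hl, hk, h])

section Comparison

variable {T R : EuclideanSpace ℝ (Fin q) →ₗ[ℝ] EuclideanSpace ℝ (Fin q)} {s : ℝ} {p : ℕ}

/-- Among symmetric operators between `0` and `1` with given integral trace, orthogonal
projections maximize `formPower`. -/
theorem formPower_le_of_isIdempotentElem (hs : 1 < s)
    (hT : T.IsSymmetric) (hT0 : ∀ x, 0 ≤ inner ℝ x (T x)) (hT1 : ∀ x, inner ℝ x (T x) ≤ ‖x‖ ^ 2)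
    (hTp : LinearMap.trace ℝ _ T = p) (hR : R.IsSymmetric)
    (hRi : IsIdempotentElem R) (hRp : LinearMap.trace ℝ _ R = p) :
    formPower s T ≤ formPower s R := by
  obtain ⟨b, l, hb, hl, hlb⟩ := exists_eigenbasis hT
  obtain ⟨c, k, hc, hk, -⟩ := exists_eigenbasis hR
  rw [formPower_eq_diagonalPower hb, formPower_eq_diagonalPower hc, diagonalPower_basis_eq c b]
  exact diagonalPower_le_zero_one b hs
    (fun i => ⟨by rw [hlb]; exact hT0 _, by rw [hlb]; simpa using hT1 (b i)⟩)
    (hl.trans hTp) ((isIdempotentElem_iff_zero_one hc).1 hRi) (hk.trans hRp)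

/-- Among symmetric operators between `0` and `1` with given integral trace, only orthogonal
projections maximize `formPower`. -/
theorem isIdempotentElem_of_formPower_le (hs : 1 < s)
    (hT : T.IsSymmetric) (hT0 : ∀ x, 0 ≤ inner ℝ x (T x)) (hT1 : ∀ x, inner ℝ x (T x) ≤ ‖x‖ ^ 2)
    (hTp : LinearMap.trace ℝ _ T = p) (hR : R.IsSymmetric)
    (hRi : IsIdempotentElem R) (hRp : LinearMap.trace ℝ _ R = p)
    (h : formPower s R ≤ formPower s T) : IsIdempotentElem T := by
  obtain ⟨b, l, hb, hl, hlb⟩ := exists_eigenbasis hT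
  obtain ⟨c, k, hc, hk, -⟩ := exists_eigenbasis hR
  rw [formPower_eq_diagonalPower hb, formPower_eq_diagonalPower hc,
    diagonalPower_basis_eq c b] at h
  rw [isIdempotentElem_iff_zero_one hb]
  refine zero_one_of_isMaxOn_diagonalPower b hs
    (fun i => ⟨by rw [hlb]; exact hT0 _, by rw [hlb]; simpa using hT1 (b i)⟩)
    (hl.trans hTp) fun n hn hnp => le_trans ?_ h
  exact diagonalPower_le_zero_one b hs hn hnp ((isIdempotentElem_iff_zero_one hc).1 hRi)
    (hk.trans hRp)

end Comparison

/-- The integral of a quadratic form over the unit sphere depends only on its trace. -/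
theorem formPower_one_eq_of_trace_eq
    {T R : EuclideanSpace ℝ (Fin q) →ₗ[ℝ] EuclideanSpace ℝ (Fin q)}
    (hT : T.IsSymmetric) (hR : R.IsSymmetric)
    (h : LinearMap.trace ℝ _ T = LinearMap.trace ℝ _ R) : formPower 1 T = formPower 1 R := by
  obtain ⟨b, l, hb, hl, -⟩ := exists_eigenbasis hT
  obtain ⟨c, k, hc, hk, -⟩ := exists_eigenbasis hR
  rw [formPower_eq_diagonalPower hb, formPower_eq_diagonalPower hc, diagonalPower_basis_eq c b]
  -- With exponent `1` the integral is linear in the eigenvalues, and permutation symmetry makes all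
  -- coefficients equal.
  have hlin : ∀ n : Fin q → ℝ,
      diagonalPower b 1 n = ∑ i, n i * diagonalPower b 1 (Pi.single i 1) := fun n => by
    simp only [diagonalPower, Real.rpow_one]
    rw [integral_finsetSum _ fun i _ => integrable_sphere_of_continuous (by fun_prop)]
    refine Finset.sum_congr rfl fun i _ => ?_
    rw [integral_const_mul]
    simp [Pi.single_apply]
  have hconst : ∀ i j, diagonalPower b 1 (Pi.single i 1) = diagonalPower b 1 (Pi.single j 1) :=
    fun i j => diagonalPower_eq_of_zero_one b b 1
      (fun r => by by_cases hr : r = i <;> simp [hr])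
      (fun r => by by_cases hr : r = j <;> simp [hr]) (by simp)
  rw [hlin l, hlin k]
  rcases isEmpty_or_nonempty (Fin q) with hq | ⟨⟨i⟩⟩
  · simp
  · simp only [hconst _ i, ← Finset.sum_mul, hl, hk, h]

/-! ### The direct sum and the mean of the diagonal blocks -/

theorem inner_copy_left (r : Fin m) (x : EuclideanSpace ℝ (Fin q)) (z : CopySum m q) :
    inner ℝ (copy r x) z = inner ℝ x (z r) := by
  rw [PiLp.inner_apply, Finset.sum_eq_single r]
  · simp [copy]
  · intro k _ hk
    simp [copy, hk]
  · simp

theorem inner_copy_right (r : Fin m) (x : EuclideanSpace ℝ (Fin q)) (z : CopySum m q) :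
    inner ℝ z (copy r x) = inner ℝ (z r) x := by
  rw [real_inner_comm, inner_copy_left, real_inner_comm]

theorem copy_apply_self (r : Fin m) (x : EuclideanSpace ℝ (Fin q)) : copy r x r = x := by
  simp [copy]

theorem copy_apply_of_ne {r k : Fin m} (h : k ≠ r) (x : EuclideanSpace ℝ (Fin q)) :
    copy r x k = 0 := by
  simp [copy, h]

theorem norm_copy (r : Fin m) (x : EuclideanSpace ℝ (Fin q)) : ‖copy r x‖ = ‖x‖ := by
  have h := inner_copy_left r x (copy r x)
  rw [copy_apply_self, real_inner_self_eq_norm_sq, real_inner_self_eq_norm_sq] at h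
  exact (sq_eq_sq₀ (norm_nonneg _) (norm_nonneg _)).1 h

theorem sum_copy_apply (z : CopySum m q) : ∑ r, copy r (z r) = z := by
  refine ext_inner_right ℝ fun w => ?_
  rw [sum_inner, PiLp.inner_apply z w]
  exact Finset.sum_congr rfl fun r _ => inner_copy_left r _ w

/-- The projection of the direct sum to its `r`-th summand. -/
def component (r : Fin m) : CopySum m q →ₗ[ℝ] EuclideanSpace ℝ (Fin q) where
  toFun z := z r
  map_add' _ _ := rfl
  map_smul' _ _ := rfl

theorem component_apply (r : Fin m) (z : CopySum m q) : component r z = z r := rfl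

/-- The average of the diagonal blocks of the orthogonal projection to `V`. -/
def blockMean (V : Submodule ℝ (CopySum m q)) :
    EuclideanSpace ℝ (Fin q) →ₗ[ℝ] EuclideanSpace ℝ (Fin q) :=
  (m : ℝ)⁻¹ • ∑ r : Fin m, component r ∘ₗ V.starProjection.toLinearMap ∘ₗ copy r

theorem inner_starProjection_starProjection (V : Submodule ℝ (CopySum m q)) (z w : CopySum m q) :
    inner ℝ (V.starProjection z) (V.starProjection w) = inner ℝ z (V.starProjection w) := by
  rw [Submodule.inner_starProjection_left_eq_right,
    Submodule.starProjection_eq_self_iff.2 (V.starProjection_apply_mem w)]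

/-- For `x = y` the sum is the trace of the Gram matrix whose determinant enters `M(V)`. -/
theorem inner_blockMean (V : Submodule ℝ (CopySum m q)) (x y : EuclideanSpace ℝ (Fin q)) :
    inner ℝ x (blockMean V y) =
      (m : ℝ)⁻¹ * ∑ r, inner ℝ (V.starProjection (copy r x)) (V.starProjection (copy r y)) := by
  simp [blockMean, inner_smul_right, inner_sum, component_apply,
    inner_starProjection_starProjection, inner_copy_left]

theorem isSymmetric_blockMean (V : Submodule ℝ (CopySum m q)) : (blockMean V).IsSymmetric := by
  intro x y
  rw [real_inner_comm, inner_blockMean, inner_blockMean]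
  simp only [real_inner_comm]

theorem inner_blockMean_nonneg (V : Submodule ℝ (CopySum m q)) (x : EuclideanSpace ℝ (Fin q)) :
    0 ≤ inner ℝ x (blockMean V x) := by
  rw [inner_blockMean]
  exact mul_nonneg (by positivity) (Finset.sum_nonneg fun r _ => real_inner_self_nonneg)

theorem norm_sq_starProjection_copy_le (V : Submodule ℝ (CopySum m q)) (r : Fin m)
    (x : EuclideanSpace ℝ (Fin q)) :
    inner ℝ (V.starProjection (copy r x)) (V.starProjection (copy r x)) ≤ ‖x‖ ^ 2 := by
  rw [real_inner_self_eq_norm_sq, ← norm_copy r x]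
  gcongr
  exact V.norm_starProjection_apply_le _

theorem inner_blockMean_le (hm : m ≠ 0) (V : Submodule ℝ (CopySum m q))
    (x : EuclideanSpace ℝ (Fin q)) : inner ℝ x (blockMean V x) ≤ ‖x‖ ^ 2 := by
  have hm' : (0 : ℝ) < m := by positivity
  rw [inner_blockMean, inv_mul_le_iff₀ hm']
  refine (Finset.sum_le_sum fun r _ => norm_sq_starProjection_copy_le V r x).trans ?_
  simp

theorem trace_starProjection {E : Type*} [NormedAddCommGroup E] [InnerProductSpace ℝ E]
    [FiniteDimensional ℝ E] (V : Submodule ℝ E) :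
    LinearMap.trace ℝ E V.starProjection.toLinearMap = Module.finrank ℝ V := by
  have h : LinearMap.IsProj V V.starProjection.toLinearMap :=
    ⟨fun z => V.starProjection_apply_mem z, fun z hz => Submodule.starProjection_eq_self_iff.2 hz⟩
  exact h.trace

/-- Cyclicity of the trace moves each `component r` behind `copy r`, and the maps `copy r ∘ₗ
component r` sum to the identity. -/
theorem trace_blockMean (V : Submodule ℝ (CopySum m q)) :
    LinearMap.trace ℝ _ (blockMean V) = (m : ℝ)⁻¹ * Module.finrank ℝ V := by
  have hid : ∑ r : Fin m, (copy r : EuclideanSpace ℝ (Fin q) →ₗ[ℝ] _) ∘ₗ component r =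
      LinearMap.id := by
    ext1 z
    simp [component_apply, sum_copy_apply]
  rw [← trace_starProjection V, blockMean, map_smul, map_sum, smul_eq_mul]
  congr 1
  calc _ = ∑ r : Fin m, LinearMap.trace ℝ (CopySum m q)
        (V.starProjection.toLinearMap ∘ₗ (copy r ∘ₗ component r)) :=
        Finset.sum_congr rfl fun r _ => by
          rw [LinearMap.trace_comp_comm', LinearMap.comp_assoc]
    _ = _ := by
        simp only [← Module.End.mul_eq_comp, ← map_sum, ← Finset.mul_sum] at hid ⊢
        rw [hid]
        rfl

theorem trace_blockMean_eq (hm : m ≠ 0) {V : Submodule ℝ (CopySum m q)} {p : ℕ}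
    (hV : Module.finrank ℝ V = m * p) : LinearMap.trace ℝ _ (blockMean V) = p := by
  rw [trace_blockMean, hV]
  have hm' : (m : ℝ) ≠ 0 := by exact_mod_cast hm
  push_cast
  field_simp

/-! ### Product planes -/

section Product

/-- The plane `U ⊕ I(U) ⊕ ⋯ ⊕ I^{m-1}(U)`. -/
def productPlane (m : ℕ) (U : Submodule ℝ (EuclideanSpace ℝ (Fin q))) :
    Submodule ℝ (CopySum m q) :=
  ⨆ r : Fin m, U.map (copy r)

variable {U : Submodule ℝ (EuclideanSpace ℝ (Fin q))}

theorem copy_mem_productPlane (r : Fin m) {x : EuclideanSpace ℝ (Fin q)} (hx : x ∈ U) :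
    copy r x ∈ productPlane m U :=
  le_iSup (fun r : Fin m => U.map (copy r)) r (Submodule.mem_map_of_mem hx)

theorem apply_mem_of_mem_productPlane {z : CopySum m q} (hz : z ∈ productPlane m U)
    (r : Fin m) : z r ∈ U := by
  have h : productPlane m U ≤ U.comap (component r) := by
    refine iSup_le fun k => Submodule.map_le_iff_le_comap.2 fun x hx => ?_
    simp only [Submodule.mem_comap, component_apply]
    by_cases hkr : r = k
    · rw [hkr, copy_apply_self]
      exact hx
    · rw [copy_apply_of_ne hkr]
      exact U.zero_mem
  exact h hz

theorem starProjection_productPlane_copy (r : Fin m) (x : EuclideanSpace ℝ (Fin q)) :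
    (productPlane m U).starProjection (copy r x) = copy r (U.starProjection x) := by
  refine Submodule.eq_starProjection_of_mem_of_inner_eq_zero
    (copy_mem_productPlane r (U.starProjection_apply_mem x)) fun w hw => ?_
  rw [← map_sub, inner_copy_left]
  exact U.starProjection_inner_eq_zero _ _ (apply_mem_of_mem_productPlane hw r)

theorem blockMean_productPlane (hm : m ≠ 0) (U : Submodule ℝ (EuclideanSpace ℝ (Fin q))) :
    blockMean (productPlane m U) = U.starProjection.toLinearMap := by
  have hm' : (m : ℝ) ≠ 0 := by exact_mod_cast hm
  ext1 x
  simp only [blockMean, LinearMap.smul_apply, LinearMap.sum_apply, LinearMap.comp_apply,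
    component_apply, ContinuousLinearMap.coe_coe, starProjection_productPlane_copy,
    copy_apply_self, Finset.sum_const, Finset.card_univ, Fintype.card_fin]
  rw [← Nat.cast_smul_eq_nsmul ℝ, smul_smul, inv_mul_cancel₀ hm', one_smul]

theorem finrank_productPlane (hm : m ≠ 0) (U : Submodule ℝ (EuclideanSpace ℝ (Fin q))) :
    Module.finrank ℝ (productPlane m U) = m * Module.finrank ℝ U := by
  have hm' : (m : ℝ) ≠ 0 := by exact_mod_cast hm
  have h := trace_blockMean (productPlane m U)
  rw [blockMean_productPlane hm, trace_starProjection] at h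
  field_simp at h
  rw [mul_comm]
  exact_mod_cast h.symm

theorem isIdempotentElem_starProjection_toLinearMap
    (U : Submodule ℝ (EuclideanSpace ℝ (Fin q))) :
    IsIdempotentElem U.starProjection.toLinearMap :=
  LinearMap.ext fun x => Submodule.starProjection_eq_self_iff.2 (U.starProjection_apply_mem x)

/-- If the average of the diagonal blocks is a projection, the plane is a product. -/
theorem eq_productPlane_of_isIdempotentElem (hm : m ≠ 0) {V : Submodule ℝ (CopySum m q)} {p : ℕ}
    (hV : Module.finrank ℝ V = m * p) (hi : IsIdempotentElem (blockMean V)) :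
    ∃ U : Submodule ℝ (EuclideanSpace ℝ (Fin q)),
      Module.finrank ℝ U = p ∧ V = productPlane m U := by
  have hm' : (m : ℝ) ≠ 0 := by exact_mod_cast hm
  have hU : Module.finrank ℝ (LinearMap.range (blockMean V)) = p := by
    have h := (LinearMap.IsIdempotentElem.isProj_range _ hi).trace
    rw [trace_blockMean_eq hm hV] at h
    exact_mod_cast h.symm
  refine ⟨LinearMap.range (blockMean V), hU, ?_⟩
  symm
  refine Submodule.eq_of_le_of_finrank_eq (iSup_le fun r => ?_) ?_
  · rintro _ ⟨x, hx, rfl⟩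
    have hx' : blockMean V x = x := (LinearMap.IsIdempotentElem.isProj_range _ hi).map_id x hx
    -- Each of the `m` terms is at most `‖x‖ ^ 2` and their sum is `m * ‖x‖ ^ 2`, so every term is
    -- extremal; a vector whose projection keeps its norm lies in `V`.
    have hsum : ∑ r, inner ℝ (V.starProjection (copy r x)) (V.starProjection (copy r x)) =
        ∑ _r : Fin m, ‖x‖ ^ 2 := by
      have h := inner_blockMean V x x
      rw [hx', real_inner_self_eq_norm_sq] at h
      rw [h]
      simp [hm']
    have h := (Finset.sum_eq_sum_iff_of_le
      fun r _ => norm_sq_starProjection_copy_le V r x).1 hsum r (Finset.mem_univ r)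
    rw [real_inner_self_eq_norm_sq, ← norm_copy r x,
      sq_eq_sq₀ (norm_nonneg _) (norm_nonneg _)] at h
    exact (V.mem_iff_norm_starProjection _).2 h
  · change Module.finrank ℝ (productPlane m _) = _
    rw [finrank_productPlane hm, hU, hV]

end Product

/-! ### The mean inequality for projected volumes -/

section Volume

/-- The arithmetic-geometric mean inequality for the eigenvalues of a positive semidefinite
matrix. -/
theorem sqrt_det_le_of_posSemidef (hm : m ≠ 0) {A : Matrix (Fin m) (Fin m) ℝ}
    (hA : A.PosSemidef) : √A.det ≤ ((m : ℝ)⁻¹ * A.trace) ^ ((m : ℝ) / 2) := by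
  have hm' : (0 : ℝ) < m := by positivity
  have hnn : ∀ i, 0 ≤ hA.isHermitian.eigenvalues i := hA.eigenvalues_nonneg
  have h := Real.geom_mean_le_arith_mean Finset.univ (fun _ => (1 : ℝ))
    hA.isHermitian.eigenvalues (by simp) (by simpa using Nat.pos_of_ne_zero hm) (by simpa using hnn)
  have hdet : A.det = ∏ i, hA.isHermitian.eigenvalues i := by
    simpa using hA.isHermitian.det_eq_prod_eigenvalues
  have htr : A.trace = ∑ i, hA.isHermitian.eigenvalues i := by
    simpa using hA.isHermitian.trace_eq_sum_eigenvalues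
  simp only [Real.rpow_one, one_mul, Finset.sum_const, Finset.card_univ, Fintype.card_fin,
    nsmul_eq_mul, mul_one, ← hdet, ← htr] at h
  have hdet0 : 0 ≤ A.det := hdet ▸ Finset.prod_nonneg fun i _ => hnn i
  calc √A.det = (A.det ^ (m : ℝ)⁻¹) ^ ((m : ℝ) / 2) := by
        rw [← Real.rpow_mul hdet0, Real.sqrt_eq_rpow]
        congr 1
        field_simp
    _ ≤ _ := by
        rw [inv_mul_eq_div]
        exact Real.rpow_le_rpow (Real.rpow_nonneg hdet0 _) h (by positivity)

/-- The volume of the projection of `x ∧ I(x) ∧ ⋯ ∧ I^{m-1}(x)` to `V`. -/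
def copyVolume (V : Submodule ℝ (CopySum m q)) (x : EuclideanSpace ℝ (Fin q)) : ℝ :=
  projectedVolume V fun r : Fin m => copy r x

theorem copyVolume_le (hm : m ≠ 0) (V : Submodule ℝ (CopySum m q))
    (x : EuclideanSpace ℝ (Fin q)) :
    copyVolume V x ≤ (inner ℝ x (blockMean V x)) ^ ((m : ℝ) / 2) := by
  rw [inner_blockMean]
  exact sqrt_det_le_of_posSemidef hm
    (Matrix.posSemidef_gram ℝ fun r : Fin m => V.starProjection (copy r x))

theorem continuous_copyVolume (V : Submodule ℝ (CopySum m q)) : Continuous (copyVolume V) := by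
  have hcopy : ∀ r : Fin m, Continuous (copy r : EuclideanSpace ℝ (Fin q) →ₗ[ℝ] CopySum m q) :=
    fun r =>
    AddMonoidHomClass.continuous_of_bound (copy r) 1 fun x => by rw [norm_copy, one_mul]
  refine Real.continuous_sqrt.comp (Continuous.matrix_det ?_)
  refine continuous_matrix fun i j => ?_
  exact (V.starProjection.continuous.comp (hcopy i)).inner
    (V.starProjection.continuous.comp (hcopy j))

theorem continuous_inner_rpow (T : EuclideanSpace ℝ (Fin q) →ₗ[ℝ] EuclideanSpace ℝ (Fin q))
    {s : ℝ} (hs : 0 ≤ s) : Continuous fun x : EuclideanSpace ℝ (Fin q) => (inner ℝ x (T x)) ^ s :=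
  (continuous_id.inner (LinearMap.continuous_of_finiteDimensional T)).rpow_const
    fun _ => Or.inr hs

theorem sphereIntegral_le_formPower (hm : m ≠ 0) (V : Submodule ℝ (CopySum m q)) :
    sphereIntegral V ≤ formPower ((m : ℝ) / 2) (blockMean V) :=
  integral_mono
    (integrable_sphere_of_continuous ((continuous_copyVolume V).comp continuous_subtype_val))
    (integrable_sphere_of_continuous
      ((continuous_inner_rpow (blockMean V) (by positivity)).comp continuous_subtype_val))
    fun x => copyVolume_le hm V x

/-- The projection acts on each summand separately, so the Gram matrix is scalar: the equality case
of the mean inequality. -/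
theorem copyVolume_productPlane (U : Submodule ℝ (EuclideanSpace ℝ (Fin q)))
    (x : EuclideanSpace ℝ (Fin q)) :
    copyVolume (productPlane m U) x = (inner ℝ x (U.starProjection x)) ^ ((m : ℝ) / 2) := by
  have hnn : 0 ≤ inner ℝ x (U.starProjection x) := by
    simpa [real_inner_comm] using U.re_inner_starProjection_nonneg x
  have hG : (Matrix.of fun i j : Fin m => inner ℝ
      ((productPlane m U).starProjection (copy i x))
      ((productPlane m U).starProjection (copy j x))) =
      Matrix.diagonal fun _ => inner ℝ x (U.starProjection x) := by
    ext i j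
    rw [Matrix.of_apply, inner_starProjection_starProjection, inner_copy_left,
      starProjection_productPlane_copy]
    by_cases hij : i = j
    · rw [hij, copy_apply_self, Matrix.diagonal_apply_eq]
    · rw [copy_apply_of_ne hij, Matrix.diagonal_apply_ne _ hij, inner_zero_right]
  rw [copyVolume, projectedVolume, polyvectorVolume, hG, Matrix.det_diagonal, Finset.prod_const,
    Finset.card_univ, Fintype.card_fin, Real.sqrt_eq_rpow, ← Real.rpow_natCast,
    ← Real.rpow_mul hnn]
  congr 1
  ring

theorem sphereIntegral_productPlane (U : Submodule ℝ (EuclideanSpace ℝ (Fin q))) :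
    sphereIntegral (productPlane m U) =
      formPower ((m : ℝ) / 2) U.starProjection.toLinearMap :=
  integral_congr_ae (.of_forall fun x => copyVolume_productPlane U x)

end Volume

/-! ### Maximal planes -/

theorem trace_starProjection_eq {U : Submodule ℝ (EuclideanSpace ℝ (Fin q))}
    (hU : Module.finrank ℝ U = p) : LinearMap.trace ℝ _ U.starProjection.toLinearMap = p := by
  rw [trace_starProjection, hU]

theorem exists_eq_productPlane_one (V : Submodule ℝ (CopySum 1 q)) :
    ∃ U : Submodule ℝ (EuclideanSpace ℝ (Fin q)), V = productPlane 1 U := by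
  refine ⟨V.comap (copy 0), le_antisymm (fun z hz => ?_) (iSup_le fun r => ?_)⟩
  · have h := sum_copy_apply z
    rw [Fin.sum_univ_one] at h
    rw [← h]
    refine copy_mem_productPlane 0 ?_
    rw [Submodule.mem_comap, h]
    exact hz
  · rw [Subsingleton.elim r 0]
    exact Submodule.map_comap_le _ _

/-- The exponent `m / 2` gives strict convexity for `m > 2` and linearity for `m = 2`. For `m = 1`
convexity fails, but `blockMean V` is then itself a projection of rank `p`. -/
theorem formPower_blockMean_le (hm : m ≠ 0) {V : Submodule ℝ (CopySum m q)}
    (hV : Module.finrank ℝ V = m * p) {U : Submodule ℝ (EuclideanSpace ℝ (Fin q))}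
    (hU : Module.finrank ℝ U = p) :
    formPower ((m : ℝ) / 2) (blockMean V) ≤
      formPower ((m : ℝ) / 2) U.starProjection.toLinearMap := by
  rcases Nat.lt_trichotomy m 2 with h | rfl | h
  · obtain rfl : m = 1 := by omega
    obtain ⟨W, rfl⟩ := exists_eq_productPlane_one V
    have htr := trace_blockMean_eq hm hV
    rw [blockMean_productPlane hm] at htr ⊢
    exact (formPower_eq_of_isIdempotentElem _ W.starProjection_isSymmetric
      (isIdempotentElem_starProjection_toLinearMap W) U.starProjection_isSymmetric
      (isIdempotentElem_starProjection_toLinearMap U)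
      (htr.trans (trace_starProjection_eq hU).symm)).le
  · rw [Nat.cast_ofNat, div_self two_ne_zero]
    exact (formPower_one_eq_of_trace_eq (isSymmetric_blockMean V) U.starProjection_isSymmetric
      ((trace_blockMean_eq hm hV).trans (trace_starProjection_eq hU).symm)).le
  · have hs : 1 < (m : ℝ) / 2 := by
      rw [lt_div_iff₀ two_pos, one_mul]
      exact_mod_cast h
    exact formPower_le_of_isIdempotentElem hs (isSymmetric_blockMean V) (inner_blockMean_nonneg V)
      (inner_blockMean_le hm V) (trace_blockMean_eq hm hV) U.starProjection_isSymmetric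
      (isIdempotentElem_starProjection_toLinearMap U) (trace_starProjection_eq hU)

theorem isMaximalPlane_of_isProductPlane (hm : m ≠ 0) {V : Submodule ℝ (CopySum m q)}
    (h : IsProductPlane p V) : IsMaximalPlane p V := by
  obtain ⟨U, hU, hVU⟩ := h
  obtain rfl : V = productPlane m U := hVU
  refine ⟨by rw [finrank_productPlane hm, hU], fun V' hV' => ?_⟩
  rw [sphereIntegral_productPlane]
  exact (sphereIntegral_le_formPower hm V').trans (formPower_blockMean_le hm hV' hU)

theorem exists_submodule_finrank_eq (hpq : p ≤ q) :
    ∃ U : Submodule ℝ (EuclideanSpace ℝ (Fin q)), Module.finrank ℝ U = p := by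
  obtain ⟨f, hf⟩ := exists_linearIndependent_of_le_finrank
    (R := ℝ) (M := EuclideanSpace ℝ (Fin q)) (n := p) (by simpa using hpq)
  exact ⟨Submodule.span ℝ (range f), by simpa using finrank_span_eq_card hf⟩

theorem IsMaximalPlane.formPower_le {V : Submodule ℝ (CopySum m q)} (hm : m ≠ 0)
    (h : IsMaximalPlane p V) {U : Submodule ℝ (EuclideanSpace ℝ (Fin q))}
    (hU : Module.finrank ℝ U = p) :
    formPower ((m : ℝ) / 2) U.starProjection.toLinearMap ≤ sphereIntegral V := by
  rw [← sphereIntegral_productPlane]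
  exact h.2 _ (by rw [finrank_productPlane hm, hU])

theorem IsMaximalPlane.isProductPlane (hpq : p ≤ q) (hm : m ≠ 0) (hm2 : m ≠ 2)
    {V : Submodule ℝ (CopySum m q)} (h : IsMaximalPlane p V) : IsProductPlane p V := by
  rcases Nat.lt_trichotomy m 2 with h2 | h2 | h2
  · obtain rfl : m = 1 := by omega
    obtain ⟨U, rfl⟩ := exists_eq_productPlane_one V
    have hU := h.1
    rw [finrank_productPlane hm, one_mul, one_mul] at hU
    exact ⟨U, hU, rfl⟩
  · exact absurd h2 hm2
  · have hs : 1 < (m : ℝ) / 2 := by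
      rw [lt_div_iff₀ two_pos, one_mul]
      exact_mod_cast h2
    obtain ⟨U, hU⟩ := exists_submodule_finrank_eq hpq
    refine eq_productPlane_of_isIdempotentElem hm h.1
      (isIdempotentElem_of_formPower_le hs (isSymmetric_blockMean V) (inner_blockMean_nonneg V)
        (inner_blockMean_le hm V) (trace_blockMean_eq hm h.1) U.starProjection_isSymmetric
        (isIdempotentElem_starProjection_toLinearMap U) (trace_starProjection_eq hU)
        ((h.formPower_le hm hU).trans (sphereIntegral_le_formPower hm V)))

/-! ### The case `m = 2` and complex subspaces -/

section Complex

variable {V : Submodule ℝ (CopySum 2 q)}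

theorem complexStructure_apply (z : CopySum 2 q) :
    complexStructure q z = copy 1 (z 0) - copy 0 (z 1) := rfl

theorem inner_complexStructure_left (z w : CopySum 2 q) :
    inner ℝ (complexStructure q z) w = -inner ℝ z (complexStructure q w) := by
  simp only [complexStructure_apply, inner_sub_left, inner_sub_right, inner_copy_left,
    inner_copy_right]
  ring

theorem inner_complexStructure_complexStructure (z w : CopySum 2 q) :
    inner ℝ (complexStructure q z) (complexStructure q w) = inner ℝ z w := by
  rw [complexStructure_apply, inner_sub_left, inner_copy_left, inner_copy_left, PiLp.inner_apply z w,
    Fin.sum_univ_two, complexStructure_apply]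
  simp only [PiLp.sub_apply, copy_apply_self, copy_apply_of_ne one_ne_zero,
    copy_apply_of_ne zero_ne_one, sub_zero, zero_sub, inner_neg_right, sub_neg_eq_add]

/-- Since `J` is skew, it preserves the orthogonal complement of `V` along with `V`. -/
theorem starProjection_complexStructure (hJ : ∀ z ∈ V, complexStructure q z ∈ V)
    (z : CopySum 2 q) :
    V.starProjection (complexStructure q z) = complexStructure q (V.starProjection z) := by
  refine Submodule.eq_starProjection_of_mem_of_inner_eq_zero
    (hJ _ (V.starProjection_apply_mem z)) fun w hw => ?_
  rw [← map_sub, inner_complexStructure_left, V.starProjection_inner_eq_zero _ _ (hJ w hw),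
    neg_zero]

theorem complexStructure_copy_zero (x : EuclideanSpace ℝ (Fin q)) :
    complexStructure q (copy 0 x) = copy 1 x := by
  rw [complexStructure_apply, copy_apply_self, copy_apply_of_ne one_ne_zero, map_zero, sub_zero]

theorem copyVolume_two (V : Submodule ℝ (CopySum 2 q)) (x : EuclideanSpace ℝ (Fin q)) :
    copyVolume V x =
      √(inner ℝ (V.starProjection (copy 0 x)) (V.starProjection (copy 0 x)) *
          inner ℝ (V.starProjection (copy 1 x)) (V.starProjection (copy 1 x)) -
        inner ℝ (V.starProjection (copy 0 x)) (V.starProjection (copy 1 x)) ^ 2) := by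
  rw [copyVolume, projectedVolume, polyvectorVolume, Matrix.det_fin_two]
  simp only [Matrix.of_apply]
  rw [real_inner_comm (V.starProjection (copy 0 x)) (V.starProjection (copy 1 x)), sq]

theorem inner_blockMean_two (V : Submodule ℝ (CopySum 2 q)) (x : EuclideanSpace ℝ (Fin q)) :
    inner ℝ x (blockMean V x) =
      (inner ℝ (V.starProjection (copy 0 x)) (V.starProjection (copy 0 x)) +
        inner ℝ (V.starProjection (copy 1 x)) (V.starProjection (copy 1 x))) / 2 := by
  rw [inner_blockMean, Fin.sum_univ_two]
  push_cast
  ring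

/-- The projections of `x` and `I x = J x` are `P x` and `J (P x)`: orthogonal and of equal length,
so the mean inequality is an equality. -/
theorem copyVolume_eq_of_complex (hJ : ∀ z ∈ V, complexStructure q z ∈ V)
    (x : EuclideanSpace ℝ (Fin q)) : copyVolume V x = inner ℝ x (blockMean V x) := by
  have horth : inner ℝ (V.starProjection (copy 0 x))
      (complexStructure q (V.starProjection (copy 0 x))) = 0 := by
    have h := inner_complexStructure_left (V.starProjection (copy 0 x))
      (V.starProjection (copy 0 x))
    rw [real_inner_comm] at h
    linarith
  rw [copyVolume_two, inner_blockMean_two, ← complexStructure_copy_zero,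
    starProjection_complexStructure hJ, inner_complexStructure_complexStructure, horth]
  rw [zero_pow two_ne_zero, sub_zero, Real.sqrt_mul_self real_inner_self_nonneg]
  ring

theorem sphereIntegral_eq_of_complex (hJ : ∀ z ∈ V, complexStructure q z ∈ V) :
    sphereIntegral V = formPower 1 (blockMean V) := by
  refine integral_congr_ae (.of_forall fun x => ?_)
  dsimp only
  rw [Real.rpow_one]
  exact copyVolume_eq_of_complex hJ x

theorem isMaximalPlane_of_complex (hV : Module.finrank ℝ V = 2 * p)
    (hJ : ∀ z ∈ V, complexStructure q z ∈ V) : IsMaximalPlane p V := by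
  refine ⟨hV, fun V' hV' => (sphereIntegral_le_formPower two_ne_zero V').trans ?_⟩
  rw [sphereIntegral_eq_of_complex hJ, Nat.cast_ofNat, div_self two_ne_zero]
  exact (formPower_one_eq_of_trace_eq (isSymmetric_blockMean V') (isSymmetric_blockMean V)
    ((trace_blockMean_eq two_ne_zero hV').trans (trace_blockMean_eq two_ne_zero hV).symm)).le

/-- The equality case of the arithmetic-geometric mean inequality for a Gram determinant of
order two. -/
theorem eq_and_eq_zero_of_sqrt_eq {a b c : ℝ} (hc : c ^ 2 ≤ a * b)
    (h : √(a * b - c ^ 2) = (a + b) / 2) : a = b ∧ c = 0 := by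
  have hsq : a * b - c ^ 2 = ((a + b) / 2) ^ 2 := by rw [← h, Real.sq_sqrt (sub_nonneg.2 hc)]
  -- The left side is the difference `((a + b) / 2) ^ 2 - (a * b - c ^ 2)`.
  have h0 : ((a - b) / 2) ^ 2 + c ^ 2 = 0 := by linear_combination -hsq
  have h1 := (add_eq_zero_iff_of_nonneg (sq_nonneg _) (sq_nonneg _)).1 h0
  rw [sq_eq_zero_iff, sq_eq_zero_iff] at h1
  exact ⟨by linarith [h1.1], h1.2⟩

/-- The upper bound `formPower 1 (blockMean V)` is the same for all `2p`-planes and is attained by a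
product plane, which exists as `p ≤ q`. A maximal plane attains it too, and continuity makes the
equality pointwise. -/
theorem IsMaximalPlane.copyVolume_eq (hpq : p ≤ q) (h : IsMaximalPlane p V)
    (x : Metric.sphere (0 : EuclideanSpace ℝ (Fin q)) 1) :
    copyVolume V x = inner ℝ (x : EuclideanSpace ℝ (Fin q)) (blockMean V x) := by
  obtain ⟨U, hU⟩ := exists_submodule_finrank_eq hpq
  have hle : formPower 1 (blockMean V) ≤ sphereIntegral V := by
    have h1 := h.formPower_le two_ne_zero hU
    rw [Nat.cast_ofNat, div_self two_ne_zero] at h1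
    rwa [formPower_one_eq_of_trace_eq (isSymmetric_blockMean V) U.starProjection_isSymmetric
      ((trace_blockMean_eq two_ne_zero h.1).trans (trace_starProjection_eq hU).symm)]
  have heq := eq_of_integral_sphere_le
    ((continuous_copyVolume V).comp continuous_subtype_val)
    ((continuous_inner_rpow (blockMean V) zero_le_one).comp continuous_subtype_val)
    (fun x => by
      have := copyVolume_le two_ne_zero V (x : EuclideanSpace ℝ (Fin q))
      rwa [Nat.cast_ofNat, div_self two_ne_zero] at this) hle
  simpa using congrFun heq x

/-- At a maximal plane the two blocks of the quadratic form agree and the mixed block vanishes. -/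
theorem IsMaximalPlane.inner_copy_eq (hpq : p ≤ q) (h : IsMaximalPlane p V)
    (x : EuclideanSpace ℝ (Fin q)) :
    inner ℝ (copy 0 x) (V.starProjection (copy 0 x)) =
        inner ℝ (copy 1 x) (V.starProjection (copy 1 x)) ∧
      inner ℝ (copy 0 x) (V.starProjection (copy 1 x)) = 0 := by
  rcases eq_or_ne x 0 with rfl | hx
  · simp
  have hn : ‖x‖ ≠ 0 := norm_ne_zero_iff.2 hx
  -- The volume identity is known on the unit sphere only; the conclusion is homogeneous in `x`.
  obtain ⟨u, hu⟩ : ∃ u : Metric.sphere (0 : EuclideanSpace ℝ (Fin q)) 1,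
      x = ‖x‖ • (u : EuclideanSpace ℝ (Fin q)) :=
    ⟨⟨‖x‖⁻¹ • x, by simp [norm_smul, hn]⟩, by simp [smul_smul, hn]⟩
  have hvol := h.copyVolume_eq hpq u
  rw [copyVolume_two, inner_blockMean_two] at hvol
  have hself := eq_and_eq_zero_of_sqrt_eq (by
    rw [sq]
    exact real_inner_mul_inner_self_le _ _) hvol
  simp only [inner_starProjection_starProjection] at hself
  rw [hu]
  simp only [map_smul, inner_smul_left, inner_smul_right, hself.1, hself.2, mul_zero, and_self]

/-- Polarization of the quadratic identities at `x + y`: the diagonal blocks of `P` coincide and the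
mixed block is skew. -/
theorem IsMaximalPlane.inner_copy_polarized (hpq : p ≤ q) (h : IsMaximalPlane p V)
    (x y : EuclideanSpace ℝ (Fin q)) :
    inner ℝ (copy 0 x) (V.starProjection (copy 0 y)) =
        inner ℝ (copy 1 x) (V.starProjection (copy 1 y)) ∧
      inner ℝ (copy 0 x) (V.starProjection (copy 1 y)) =
        -inner ℝ (copy 1 x) (V.starProjection (copy 0 y)) := by
  have hsymm : ∀ z w, inner ℝ z (V.starProjection w) = inner ℝ w (V.starProjection z) :=
    fun z w => by rw [← V.inner_starProjection_left_eq_right, real_inner_comm]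
  have hx := h.inner_copy_eq hpq x
  have hy := h.inner_copy_eq hpq y
  have hxy := h.inner_copy_eq hpq (x + y)
  simp only [map_add, inner_add_left, inner_add_right] at hxy
  rw [hsymm (copy 0 y) (copy 0 x), hsymm (copy 1 y) (copy 1 x),
    hsymm (copy 0 y) (copy 1 x)] at hxy
  constructor
  · linarith [hxy.1, hx.1, hy.1]
  · linarith [hxy.2, hx.2, hy.2]

theorem IsMaximalPlane.complexStructure_mem (hpq : p ≤ q) (h : IsMaximalPlane p V)
    {z : CopySum 2 q} (hz : z ∈ V) : complexStructure q z ∈ V := by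
  -- As `J` is skew, this is the weak form of `P J = J P`; it is checked blockwise.
  have key : ∀ a b : CopySum 2 q, inner ℝ a (V.starProjection (complexStructure q b)) =
      -inner ℝ (complexStructure q a) (V.starProjection b) := fun a b => by
    have ha := sum_copy_apply a
    have hb := sum_copy_apply b
    rw [Fin.sum_univ_two] at ha hb
    conv_lhs => rw [← ha]
    conv_rhs => rw [← hb]
    simp only [complexStructure_apply, map_add, map_sub, inner_add_left, inner_add_right,
      inner_sub_left, inner_sub_right, fun x y => (h.inner_copy_polarized hpq x y).1,
      fun x y => (h.inner_copy_polarized hpq x y).2]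
    ring
  rw [← Submodule.starProjection_eq_self_iff]
  refine ext_inner_left ℝ fun w => ?_
  rw [key, Submodule.starProjection_eq_self_iff.2 hz, inner_complexStructure_left, neg_neg]

end Complex

end SphereProjection

end

theorem proposition3p4 (p q : ℕ) (hpq : p ≤ q) :
    (∀ m : ℕ, 1 ≤ m → m ≠ 2 →
      ∀ V : Submodule ℝ (SphereProjection.CopySum m q), Module.finrank ℝ V = m * p →
        (SphereProjection.IsMaximalPlane p V ↔ SphereProjection.IsProductPlane p V)) ∧
    (∀ V : Submodule ℝ (SphereProjection.CopySum 2 q), Module.finrank ℝ V = 2 * p →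
        (SphereProjection.IsProductPlane p V → SphereProjection.IsMaximalPlane p V) ∧
        (SphereProjection.IsMaximalPlane p V ↔
          ∀ z ∈ V, SphereProjection.complexStructure q z ∈ V)) :=
  ⟨fun _ hm hm2 _ _ =>
    ⟨fun h => h.isProductPlane hpq (Nat.one_le_iff_ne_zero.1 hm) hm2,
      SphereProjection.isMaximalPlane_of_isProductPlane (Nat.one_le_iff_ne_zero.1 hm)⟩,
    fun _ hV =>
      ⟨SphereProjection.isMaximalPlane_of_isProductPlane two_ne_zero,
        fun h _ hz => h.complexStructure_mem hpq hz,
        SphereProjection.isMaximalPlane_of_complex hV⟩⟩
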